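/- Let $\mathbb{K}$ be a field and fix $k>0$. For $n>0$ let $\mathcal{V}_{k,n}$ be the set of all $v\in\mathbb{N}^n$ with $\sum_i v_i=k$. The Veronese ideal $I_{k,n}\subseteq\mathbb{K}[x_v : v\in\mathcal{V}_{k,n}]$ is the toric ideal of $\mathcal{V}_{k,n}$, that is, the ideal generated by all binomials $x^u-x^w$ with $\sum_v u_v v=\sum_v w_v v$. A partition of $[n]$ into labelled (possibly empty) blocks $N_1,\dots,N_m$ defines an $\mathbb{N}\mathcal{V}_{k,m}$-grading of $\mathbb{K}[x_v]$ by $\deg(x_v)=\bigl(\sum_{i\in N_1}v_i,\dots,\sum_{i\in N_m}v_i\bigr)\in\mathcal{V}_{k,m}$, for which $I_{k,n}$ is homogeneous. Let $I\subseteq\mathbb{K}[x_s : s\in\sigma]$ and $J\subseteq\mathbb{K}[y_t : t\in\tau]$ be ideals that are homogeneous for gradings with $\deg(x_s),\deg(y_t)\in\mathcal{V}_{k,m}$. Their toric fiber product $I\times_{\mathcal{V}_{k,m}}J$ is the kernel of the $\mathbb{K}$-algebra homomorphism $$\mathbb{K}[z_{s,t} : \deg(x_s)=\deg(y_t)]\to(\mathbb{K}[x]/I)\otimes_{\mathbb{K}}(\mathbb{K}[y]/J),\qquad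 z_{s,t}\mapsto\bar x_s\otimes\bar y_t .$$ Define the iterated toric fiber products of Veronese ideals, together with their partition gradings, inductively as follows. Every Veronese ideal $I_{k,n}$ with $n>0$ is one, and its partition gradings are those just described (for all $m$). If $I$ and $J$ are two of them, with partition gradings that have their variable degrees in the same $\mathcal{V}_{k,m}$, then $I\times_{\mathcal{V}_{k,m}}J$ is one, and its partition gradings are those of the form $\deg(z_{s,t})=\deg'(x_s)$ or $\deg(z_{s,t})=\deg'(y_t)$, where $\deg'$ is any partition grading of $I$, respectively of $J$. (In particular, the common $\mathbb{N}\mathcal{V}_{k,m}$-grading is one of them.) Then for every iterated toric fiber product $I\subseteq\mathbb{K}[x]$ of Veronese ideals the quotient ring $\mathbb{K}[x]/I$ is normal: it is an integral domain that is integrally closed in its field of fractions. -/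

import Mathlib

open scoped TensorProduct

/-- The Veronese configuration `V_{k,n}`: all vectors in `ℕ^n` whose entries sum to `k`. -/
def Veronese (k n : ℕ) : Type := {v : Fin n → ℕ // ∑ i, v i = k}

/-- The map `V_{k,n} → V_{k,m}` induced by the partition of `[n]` into the `m` labelled blocks
`p⁻¹(j)`: it is the restriction of the linear map `ℤ^n → ℤ^m` that sends the unit vector `e_i` to
`e_{p i}`. -/
def Veronese.push {k n m : ℕ} (p : Fin n → Fin m) (v : Veronese k n) : Veronese k m :=
  ⟨fun j => ∑ i with p i = j, v.1 i, by
    rw [Finset.sum_fiberwise]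
    exact v.2⟩

/-- The toric ideal of a vector configuration `b : σ → ℤ^ι`, generated by the binomials
`x^u - x^w` with `u - w` in the integer kernel of `b`. -/
noncomputable def toricIdeal (K : Type*) [Field K] {σ ι : Type*} (b : σ → ι → ℤ) :
    Ideal (MvPolynomial σ K) :=
  Ideal.span {f | ∃ u w : σ →₀ ℕ,
    (u.sum fun s a => (a : ℤ) • b s) = (w.sum fun s a => (a : ℤ) • b s) ∧
    f = MvPolynomial.monomial u 1 - MvPolynomial.monomial w 1}

/-- The Veronese ideal `I_{k,n}`, the toric ideal of the configuration `V_{k,n}`. -/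
noncomputable def veroneseIdeal (K : Type*) [Field K] (k n : ℕ) :
    Ideal (MvPolynomial (Veronese k n) K) :=
  toricIdeal K fun v (i : Fin n) => (v.1 i : ℤ)

section ToricFiberProduct

variable {K : Type*} [Field K] {σ τ A : Type*}

/-- The index set of the variables `z` of a toric fiber product: pairs of a variable `x` and a
variable `y` of the same degree. -/
def FiberIndex (d : σ → A) (e : τ → A) : Type _ := {st : σ × τ // d st.1 = e st.2}

/-- The homomorphism `φ_S : K[z] → K[x] ⊗ K[y]` that sends the variable of a pair `(x, y)` to
`x ⊗ y`. -/
noncomputable def segreHom (K : Type*) [Field K] (d : σ → A) (e : τ → A) :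
    MvPolynomial (FiberIndex d e) K →ₐ[K] MvPolynomial σ K ⊗[K] MvPolynomial τ K :=
  MvPolynomial.aeval fun z => MvPolynomial.X z.1.1 ⊗ₜ[K] MvPolynomial.X z.1.2

/-- The toric fiber product `I ×_A J`, the kernel of `(π_I ⊗ π_J) ∘ φ_S`, where the variables of
`K[x]` and of `K[y]` have the degrees `d` and `e` in `A`. -/
noncomputable def toricFiberProduct (d : σ → A) (e : τ → A)
    (I : Ideal (MvPolynomial σ K)) (J : Ideal (MvPolynomial τ K)) :
    Ideal (MvPolynomial (FiberIndex d e) K) :=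
  RingHom.ker ((Algebra.TensorProduct.map (Ideal.Quotient.mkₐ K I) (Ideal.Quotient.mkₐ K J)).comp
    (segreHom K d e))

end ToricFiberProduct

/-- An ideal in a polynomial ring, together with a set of gradings in which the variables have
their degrees in a Veronese configuration `V_{k,m}`, for every `m`. -/
structure GradedIdeal (K : Type*) [Field K] (k : ℕ) where
  /-- The variables of the polynomial ring. -/
  Var : Type
  /-- The ideal. -/
  ideal : Ideal (MvPolynomial Var K)
  /-- The gradings, each given by the degrees of the variables. -/
  gradings : ∀ m : ℕ, Set (Var → Veronese k m)

namespace GradedIdeal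

variable {K : Type*} [Field K] {k : ℕ}

/-- The Veronese ideal `I_{k,n}` with the gradings that are defined by the partitions of `[n]`. -/
noncomputable def veronese (K : Type*) [Field K] (k n : ℕ) : GradedIdeal K k where
  Var := Veronese k n
  ideal := veroneseIdeal K k n
  gradings m := {d | ∃ p : Fin n → Fin m, d = Veronese.push p}

/-- The toric fiber product over `V_{k,m}` with respect to a grading `d` of the left and a grading
`e` of the right factor. A grading of either factor grades the product: the degree of the variable
of a pair `(x, y)` is that of `x`, respectively that of `y`. (For `d` and `e` themselves the two
agree.) -/
noncomputable def tfp (X Y : GradedIdeal K k) {m : ℕ} (d : X.Var → Veronese k m)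
    (e : Y.Var → Veronese k m) : GradedIdeal K k where
  Var := FiberIndex d e
  ideal := toricFiberProduct d e X.ideal Y.ideal
  gradings m' := {f | (∃ d' ∈ X.gradings m', f = fun z => d' z.1.1) ∨
    (∃ e' ∈ Y.gradings m', f = fun z => e' z.1.2)}

/-- The iterated toric fiber products of Veronese ideals `I_{k,n}` over Veronese monoids
`ℕ V_{k,m}`, in which every common grading comes from partitions. -/
inductive IsIteratedVeronese : GradedIdeal K k → Prop
  | veronese (n : ℕ) (hn : 0 < n) : IsIteratedVeronese (veronese K k n)
  | tfp (X Y : GradedIdeal K k) (hX : IsIteratedVeronese X) (hY : IsIteratedVeronese Y)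
      (m : ℕ) (d : X.Var → Veronese k m) (hd : d ∈ X.gradings m)
      (e : Y.Var → Veronese k m) (he : e ∈ Y.gradings m) : IsIteratedVeronese (X.tfp Y d e)

end GradedIdeal

/-! Each ideal in question is the kernel of a monomial map `K[x] → K[ι]`, so its quotient is the
algebra of the monoid `M ⊆ ℕ^ι` of exponents. If `u, u + v ∈ M` forces `v ∈ M` for `v ∈ ℕ^ι`, then
discarding the monomials outside `M` is an `M`-algebra-linear retraction of `K[ι]`, and integral
closedness descends from the polynomial ring.

The presentation is built by induction. The monoid of a toric fiber product should be the fiber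
product `{(u, w) | D u = E w}` of the two monoids, which is visibly closed under subtraction. But an
arbitrary such pair need not be a sum of generators of matching degrees. The induction therefore
carries a lifting property (`exists_degree` in `IsMonomialModel`): any way of writing the degree of
an element as a sum of Veronese vectors comes from a way of writing the element as a sum of
generators. Veronese monoids have it by `exists_multiset_veronese`, and
`IsMonomialModel.toricFiberProduct` passes it on. -/

/-- A domain that embeds in an integrally closed domain `P` with a linear retraction from `P` is
integrally closed. -/
theorem isIntegrallyClosed_of_retraction {R P : Type*} [CommRing R] [IsDomain R] [CommRing P]
    [IsDomain P] [IsIntegrallyClosed P] (j : R →+* P) (hj : Function.Injective j) (ρ : P → R)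
    (hρ : ∀ r p, ρ (j r * p) = r * ρ p) (hρj : ∀ r, ρ (j r) = r) : IsIntegrallyClosed R := by
  rw [isIntegrallyClosed_iff (FractionRing R)]
  intro x hx
  obtain ⟨a, b, hb, rfl⟩ := IsFractionRing.div_surjective (A := R) x
  have hb0 : b ≠ 0 := nonZeroDivisors.ne_zero hb
  let F : FractionRing R →+* FractionRing P := IsFractionRing.map hj
  have hF : ∀ r, F (algebraMap R (FractionRing R) r) = algebraMap P (FractionRing P) (j r) :=
    fun r => IsLocalization.map_eq _ r
  have hint : IsIntegral P (F (algebraMap R _ a / algebraMap R _ b)) :=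
    hx.map_of_comp_eq j F (by ext r; simp [hF])
  obtain ⟨y, hy⟩ := IsIntegrallyClosed.isIntegral_iff.mp hint
  have hjb : algebraMap P (FractionRing P) (j b) ≠ 0 := by
    rw [Ne, FaithfulSMul.algebraMap_eq_zero_iff, map_eq_zero_iff j hj]
    exact hb0
  rw [map_div₀, hF, hF, eq_div_iff hjb, ← map_mul] at hy
  have hy' : j b * y = j a := by
    rw [mul_comm]
    exact FaithfulSMul.algebraMap_injective P (FractionRing P) hy
  -- The quotient `a / b` is `ρ y`, because `b * ρ y = ρ (j b * y) = ρ (j a) = a`.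
  refine ⟨ρ y, ?_⟩
  rw [eq_div_iff (by rwa [Ne, FaithfulSMul.algebraMap_eq_zero_iff]), ← map_mul, mul_comm, ← hρ,
    hy', hρj]

/-! ### Monomial homomorphisms and their kernels -/

section MonomialHom

open MvPolynomial

variable (K : Type*) [Field K] {σ τ ι κ : Type*}

/-- The homomorphism of polynomial rings that sends each variable to a monomial. -/
noncomputable def monomialHom (b : σ → ι →₀ ℕ) : MvPolynomial σ K →ₐ[K] MvPolynomial ι K :=
  aeval fun s => monomial (b s) 1

theorem monomialHom_monomial (b : σ → ι →₀ ℕ) (u : σ →₀ ℕ) (c : K) :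
    monomialHom K b (monomial u c) = monomial (Finsupp.linearCombination ℕ b u) c := by
  have h : (u.prod fun s n => monomial (b s) (1 : K) ^ n) =
      monomial (Finsupp.linearCombination ℕ b u) 1 := by
    simp [Finsupp.prod, Finsupp.linearCombination_apply, Finsupp.sum, monomial_pow,
      ← monomial_sum_one]
  rw [monomialHom, aeval_monomial, h, algebraMap_eq, C_mul_monomial, mul_one]

/-- A right inverse of a monomial homomorphism on monomials, modulo an ideal. -/
noncomputable def monomialSection (b : σ → ι →₀ ℕ) (I : Ideal (MvPolynomial σ K)) :
    MvPolynomial ι K →ₗ[K] MvPolynomial σ K ⧸ I :=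
  open scoped Classical in
  (basisMonomials ι K).constr K fun v =>
    if h : ∃ u, Finsupp.linearCombination ℕ b u = v then
      Ideal.Quotient.mk I (monomial h.choose 1) else 0

variable {K}

theorem monomialSection_monomial_of_not_mem {b : σ → ι →₀ ℕ} (I : Ideal (MvPolynomial σ K))
    {v : ι →₀ ℕ} (hv : ¬ ∃ u, Finsupp.linearCombination ℕ b u = v) :
    monomialSection K b I (monomial v 1) = 0 := by
  have := (basisMonomials ι K).constr_basis K (fun v => open scoped Classical in
    if h : ∃ u, Finsupp.linearCombination ℕ b u = v then
      Ideal.Quotient.mk I (monomial h.choose 1) else 0) v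
  rw [dif_neg hv, coe_basisMonomials] at this
  exact this

/-- The chosen preimage is immaterial: two preimages of one exponent differ by a binomial in `I`. -/
theorem monomialSection_monomial {b : σ → ι →₀ ℕ} {I : Ideal (MvPolynomial σ K)}
    (hI : ∀ u w, Finsupp.linearCombination ℕ b u = Finsupp.linearCombination ℕ b w →
      monomial u 1 - monomial w 1 ∈ I) (u : σ →₀ ℕ) :
    monomialSection K b I (monomial (Finsupp.linearCombination ℕ b u) 1) =
      Ideal.Quotient.mk I (monomial u 1) := by
  have := (basisMonomials ι K).constr_basis K (fun v => open scoped Classical in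
    if h : ∃ u, Finsupp.linearCombination ℕ b u = v then
      Ideal.Quotient.mk I (monomial h.choose 1) else 0) (Finsupp.linearCombination ℕ b u)
  have hu : ∃ u', Finsupp.linearCombination ℕ b u' = Finsupp.linearCombination ℕ b u := ⟨u, rfl⟩
  rw [dif_pos hu, coe_basisMonomials] at this
  exact this.trans (Ideal.Quotient.eq.mpr (hI _ _ hu.choose_spec))

theorem monomialSection_monomialHom {b : σ → ι →₀ ℕ} {I : Ideal (MvPolynomial σ K)}
    (hI : ∀ u w, Finsupp.linearCombination ℕ b u = Finsupp.linearCombination ℕ b w →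
      monomial u 1 - monomial w 1 ∈ I) (f : MvPolynomial σ K) :
    monomialSection K b I (monomialHom K b f) = Ideal.Quotient.mk I f := by
  have : monomialSection K b I ∘ₗ (monomialHom K b).toLinearMap =
      (Ideal.Quotient.mkₐ K I).toLinearMap := by
    refine (basisMonomials σ K).ext fun u => ?_
    simp [monomialHom_monomial, monomialSection_monomial hI]
  exact LinearMap.congr_fun this f

theorem sub_mem_ker_monomialHom {b : σ → ι →₀ ℕ} {u w : σ →₀ ℕ}
    (h : Finsupp.linearCombination ℕ b u = Finsupp.linearCombination ℕ b w) :
    monomial u 1 - monomial w 1 ∈ RingHom.ker (monomialHom K b) := by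
  rw [RingHom.mem_ker, map_sub, monomialHom_monomial, monomialHom_monomial, h, sub_self]

/-- The toric ideal of a nonnegative configuration is the kernel of the monomial homomorphism. -/
theorem toricIdeal_eq_ker_monomialHom (b : σ → ι →₀ ℕ) :
    toricIdeal K (fun s i => (b s i : ℤ)) = RingHom.ker (monomialHom K b) := by
  have key : ∀ u w : σ →₀ ℕ,
      (u.sum fun s a => (a : ℤ) • fun i => (b s i : ℤ)) =
        (w.sum fun s a => (a : ℤ) • fun i => (b s i : ℤ)) ↔
      Finsupp.linearCombination ℕ b u = Finsupp.linearCombination ℕ b w := by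
    have h : ∀ (u : σ →₀ ℕ) (i : ι), (u.sum fun s a => (a : ℤ) • fun i => (b s i : ℤ)) i =
        (Finsupp.linearCombination ℕ b u i : ℤ) := by
      intro u i
      simp [Finsupp.linearCombination_apply, Finsupp.sum, Finset.sum_apply]
    intro u w
    simp only [funext_iff, h, Nat.cast_inj, Finsupp.ext_iff]
  refine le_antisymm (Ideal.span_le.mpr ?_) fun f hf => ?_
  · rintro _ ⟨u, w, h, rfl⟩
    exact sub_mem_ker_monomialHom ((key u w).mp h)
  · have hI : ∀ u w, Finsupp.linearCombination ℕ b u = Finsupp.linearCombination ℕ b w →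
        monomial u 1 - monomial w 1 ∈ toricIdeal K (fun s i => (b s i : ℤ)) :=
      fun u w h => Ideal.subset_span ⟨u, w, (key u w).mpr h, rfl⟩
    -- The section recovers the class of `f` from its image, which is zero.
    rw [← Ideal.Quotient.eq_zero_iff_mem, ← monomialSection_monomialHom hI,
      RingHom.mem_ker.mp hf, map_zero]

theorem monomialSection_monomialHom_mul {b : σ → ι →₀ ℕ} {I : Ideal (MvPolynomial σ K)}
    (hI : ∀ u w, Finsupp.linearCombination ℕ b u = Finsupp.linearCombination ℕ b w →
      monomial u 1 - monomial w 1 ∈ I)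
    (hb : ∀ u v, (∃ w, Finsupp.linearCombination ℕ b w = u + v) →
      (∃ w, Finsupp.linearCombination ℕ b w = u) → ∃ w, Finsupp.linearCombination ℕ b w = v)
    (f : MvPolynomial σ K) (p : MvPolynomial ι K) :
    monomialSection K b I (monomialHom K b f * p) =
      Ideal.Quotient.mk I f * monomialSection K b I p := by
  have h : ((LinearMap.mul K (MvPolynomial ι K)).comp (monomialHom K b).toLinearMap).compr₂
        (monomialSection K b I) =
      (LinearMap.mul K (MvPolynomial σ K ⧸ I)).compl₁₂ (Ideal.Quotient.mkₐ K I).toLinearMap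
        (monomialSection K b I) := by
    refine (basisMonomials σ K).ext fun w => (basisMonomials ι K).ext fun v => ?_
    simp only [coe_basisMonomials, LinearMap.compr₂_apply, LinearMap.compl₁₂_apply,
      LinearMap.comp_apply, AlgHom.toLinearMap_apply, LinearMap.mul_apply', monomialHom_monomial,
      monomial_mul, mul_one, Ideal.Quotient.mkₐ_eq_mk]
    by_cases hv : ∃ w, Finsupp.linearCombination ℕ b w = v
    · obtain ⟨w', rfl⟩ := hv
      rw [← map_add, monomialSection_monomial hI, monomialSection_monomial hI, ← map_mul,
        monomial_mul, mul_one]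
    -- Closure under subtraction enters here: translating by the monoid cannot move an outside
    -- exponent into it.
    · rw [monomialSection_monomial_of_not_mem _ hv, monomialSection_monomial_of_not_mem _
        fun hwv => hv (hb _ _ hwv ⟨w, rfl⟩), mul_zero]
  exact LinearMap.congr_fun₂ h f p

theorem isDomain_quotient_ker_monomialHom (b : σ → ι →₀ ℕ) :
    IsDomain (MvPolynomial σ K ⧸ RingHom.ker (monomialHom K b)) :=
  (Ideal.Quotient.isDomain_iff_prime _).mpr (RingHom.ker_isPrime _)

/-- The monomial algebra of a monoid of exponents that is closed under subtraction is
integrally closed. -/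
theorem isIntegrallyClosed_quotient_ker_monomialHom (b : σ → ι →₀ ℕ)
    (hb : ∀ u v, (∃ w, Finsupp.linearCombination ℕ b w = u + v) →
      (∃ w, Finsupp.linearCombination ℕ b w = u) → ∃ w, Finsupp.linearCombination ℕ b w = v) :
    IsIntegrallyClosed (MvPolynomial σ K ⧸ RingHom.ker (monomialHom K b)) := by
  have := isDomain_quotient_ker_monomialHom (K := K) b
  have hI : ∀ u w, Finsupp.linearCombination ℕ b u = Finsupp.linearCombination ℕ b w →
      monomial u 1 - monomial w 1 ∈ RingHom.ker (monomialHom K b) :=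
    fun _ _ => sub_mem_ker_monomialHom
  let j : MvPolynomial σ K ⧸ RingHom.ker (monomialHom K b) →+* MvPolynomial ι K :=
    (Ideal.kerLiftAlg (monomialHom K b)).toRingHom
  have hj : Function.Injective j := Ideal.kerLiftAlg_injective (monomialHom K b)
  have hj_mk : ∀ f, j (Ideal.Quotient.mk _ f) = monomialHom K b f := fun _ => rfl
  refine isIntegrallyClosed_of_retraction j hj (fun p => monomialSection K b _ p)
    (fun r p => ?_) (fun r => ?_)
  · obtain ⟨f, rfl⟩ := Ideal.Quotient.mk_surjective r
    rw [hj_mk]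
    exact monomialSection_monomialHom_mul hI hb f p
  · obtain ⟨f, rfl⟩ := Ideal.Quotient.mk_surjective r
    rw [hj_mk]
    exact monomialSection_monomialHom hI f

/-! ### Toric fiber products of kernels -/

/-- A toric fiber product of kernels is the kernel of the tensor product of the maps. -/
theorem toricFiberProduct_ker {A P Q : Type*} [CommRing P] [Algebra K P] [CommRing Q] [Algebra K Q]
    (d : σ → A) (e : τ → A) (f : MvPolynomial σ K →ₐ[K] P) (g : MvPolynomial τ K →ₐ[K] Q) :
    toricFiberProduct d e (RingHom.ker f) (RingHom.ker g) =
      RingHom.ker ((Algebra.TensorProduct.map f g).comp (segreHom K d e)) := by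
  -- Modules over a field are flat, so a tensor product of injections is injective.
  have hinj : Function.Injective
      (Algebra.TensorProduct.map (Ideal.kerLiftAlg f) (Ideal.kerLiftAlg g)) :=
    TensorProduct.map_injective_of_flat_flat (Ideal.kerLiftAlg f).toLinearMap
      (Ideal.kerLiftAlg g).toLinearMap
      (Ideal.kerLiftAlg_injective f) (Ideal.kerLiftAlg_injective g)
  have hcomp : (Algebra.TensorProduct.map (Ideal.kerLiftAlg f) (Ideal.kerLiftAlg g)).comp
      (Algebra.TensorProduct.map (Ideal.Quotient.mkₐ K (RingHom.ker f))
        (Ideal.Quotient.mkₐ K (RingHom.ker g))) = Algebra.TensorProduct.map f g := by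
    rw [← Algebra.TensorProduct.map_comp]
    congr 1
  ext p
  rw [← hcomp, AlgHom.comp_assoc, RingHom.mem_ker, AlgHom.comp_apply,
    map_eq_zero_iff _ hinj]
  rfl

theorem tensorEquivSum_tmul (p : MvPolynomial σ K) (q : MvPolynomial τ K) :
    tensorEquivSum K σ τ K (p ⊗ₜ q) = rename Sum.inl p * rename Sum.inr q := by
  have h : (tensorEquivSum K σ τ K : _ →ₐ[K] MvPolynomial (σ ⊕ τ) K) =
      Algebra.TensorProduct.productMap (rename Sum.inl) (rename Sum.inr) := by
    ext i <;> simp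
  simpa using AlgHom.congr_fun h (p ⊗ₜ q)

/-- The left component of a pair of variables of the same degree. -/
def FiberIndex.left {A : Type*} {d : σ → A} {e : τ → A} (z : FiberIndex d e) : σ := z.1.1

/-- The right component of a pair of variables of the same degree. -/
def FiberIndex.right {A : Type*} {d : σ → A} {e : τ → A} (z : FiberIndex d e) : τ := z.1.2

/-- The toric fiber product of two configurations: the pairs of vectors of the same degree. -/
noncomputable def fiberConfiguration {A : Type*} (d : σ → A) (e : τ → A) (b : σ → ι →₀ ℕ)
    (c : τ → κ →₀ ℕ) (z : FiberIndex d e) : ι ⊕ κ →₀ ℕ :=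
  Finsupp.sumFinsuppAddEquivProdFinsupp.symm (b z.left, c z.right)

/-- In `K[ι] ⊗ K[κ] = K[ι ⊕ κ]`, the tensor of two monomials is the monomial of the concatenated
exponents. -/
theorem toricFiberProduct_ker_monomialHom {A : Type*} (d : σ → A) (e : τ → A) (b : σ → ι →₀ ℕ)
    (c : τ → κ →₀ ℕ) :
    toricFiberProduct d e (RingHom.ker (monomialHom K b)) (RingHom.ker (monomialHom K c)) =
      RingHom.ker (monomialHom K (fiberConfiguration d e b c)) := by
  rw [toricFiberProduct_ker]
  have h : (tensorEquivSum K ι κ K : _ →ₐ[K] MvPolynomial (ι ⊕ κ) K).comp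
      ((Algebra.TensorProduct.map (monomialHom K b) (monomialHom K c)).comp (segreHom K d e)) =
      monomialHom K (fiberConfiguration d e b c) := by
    refine MvPolynomial.algHom_ext fun z => ?_
    have hz : Finsupp.mapDomain Sum.inl (b z.left) + Finsupp.mapDomain Sum.inr (c z.right) =
        fiberConfiguration d e b c z := by
      ext (i | i)
      · simp [fiberConfiguration, Finsupp.mapDomain_apply Sum.inl_injective,
          Finsupp.mapDomain_of_notMem_range]
      · simp [fiberConfiguration, Finsupp.mapDomain_apply Sum.inr_injective,
          Finsupp.mapDomain_of_notMem_range]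
    have hz' : segreHom K d e (X z) = X z.left ⊗ₜ X z.right := aeval_X _ z
    simp [hz', monomialHom, tensorEquivSum_tmul, rename_monomial, monomial_mul, hz]
  ext p
  rw [← h]
  simp [RingHom.mem_ker]

end MonomialHom

/-! ### Splitting vectors and matching multisets -/

theorem Finset.exists_le_sum_eq_nat {ι : Type*} (s : Finset ι) (u : ι → ℕ) :
    ∀ a ≤ ∑ i ∈ s, u i, ∃ v ≤ u, ∑ i ∈ s, v i = a := by
  classical
  induction s using Finset.induction with
  | empty => exact fun a ha => ⟨0, fun _ => Nat.zero_le _, by simpa [eq_comm] using ha⟩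
  | insert i s hi ih =>
    intro a ha
    rw [Finset.sum_insert hi] at ha
    -- Greedy choice: coordinate `i` takes as much of `a` as it can.
    obtain ⟨v, hv, hs⟩ := ih (a - min a (u i)) (by omega)
    refine ⟨Function.update v i (min a (u i)), fun j => ?_, ?_⟩
    · by_cases hj : j = i
      · subst hj; simp
      · simpa [hj] using hv j
    · rw [Finset.sum_insert hi, Finset.sum_update_of_notMem hi, hs, Function.update_self]
      omega

/-- The blocks are disjoint, so the choices made in each of them glue. -/
theorem exists_le_fiberSum_eq {ι κ : Type*} [Fintype ι] [DecidableEq κ] (p : ι → κ) (u : ι → ℕ)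
    (a : κ → ℕ) (h : ∀ j, a j ≤ ∑ i with p i = j, u i) :
    ∃ v ≤ u, ∀ j, ∑ i with p i = j, v i = a j := by
  choose v hv ha using fun j => Finset.exists_le_sum_eq_nat {i | p i = j} u (a j) (h j)
  refine ⟨fun i => v (p i) i, fun i => hv _ i, fun j => ?_⟩
  rw [← ha j]
  refine Finset.sum_congr rfl fun i hi => ?_
  change v (p i) i = v j i
  rw [(Finset.mem_filter.mp hi).2]

/-- Equal multisets of degrees amount to a matching of `s` with `t` that respects degrees. -/
theorem Multiset.exists_map_fst_snd_of_map_eq {σ τ A : Type*} (d : σ → A) (e : τ → A)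
    {s : Multiset σ} {t : Multiset τ} (h : s.map d = t.map e) :
    ∃ z : Multiset (FiberIndex d e), z.map FiberIndex.left = s ∧ z.map FiberIndex.right = t := by
  have hr : Multiset.Rel (fun x y => d x = e y) s t := by
    rwa [← Multiset.rel_eq, Multiset.rel_map] at h
  clear h
  induction hr with
  | zero => exact ⟨0, rfl, rfl⟩
  | @cons x y _ _ hab _ ih =>
    obtain ⟨z, rfl, rfl⟩ := ih
    let w : FiberIndex d e := ⟨(x, y), hab⟩
    exact ⟨w ::ₘ z, Multiset.map_cons _ w z, Multiset.map_cons _ w z⟩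

theorem exists_linearCombination_nat_iff {σ M : Type*} [AddCommMonoid M] (b : σ → M) (u : M) :
    (∃ w, Finsupp.linearCombination ℕ b w = u) ↔ ∃ s : Multiset σ, (s.map b).sum = u := by
  have h : ∀ w : σ →₀ ℕ, ((Finsupp.toMultiset w).map b).sum = Finsupp.linearCombination ℕ b w := by
    intro w
    induction w using Finsupp.induction_linear with
    | zero => simp
    | add f g hf hg => simp [hf, hg]
    | single a n => simp [Finsupp.toMultiset_single, Multiset.map_nsmul, Multiset.sum_nsmul]
  constructor
  · rintro ⟨w, rfl⟩
    exact ⟨_, h w⟩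
  · classical
    rintro ⟨s, rfl⟩
    obtain ⟨w, rfl⟩ := (Multiset.toFinsupp (α := σ)).symm.surjective s
    exact ⟨w, (h w).symm⟩

/-! ### Monomial models and their fiber products -/

section MonomialModel

variable {K : Type*} [Field K] {k : ℕ} {σ τ ι κ : Type*}

/-- The coordinates of an element of the Veronese configuration. -/
def Veronese.coords {n : ℕ} (v : Veronese k n) : Fin n → ℕ := v.1

/-- A presentation of an ideal with gradings as the toric ideal of a configuration `b` in `ℕ^ι`,
whose monoid is closed under subtraction and in which every decomposition of the degree of an
element lifts to a decomposition of the element. -/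
structure IsMonomialModel (I : Ideal (MvPolynomial σ K)) (G : ∀ m, Set (σ → Veronese k m))
    (b : σ → ι →₀ ℕ) : Prop where
  ideal_eq : I = RingHom.ker (monomialHom K b)
  exists_sum_eq_of_add : ∀ u v : ι →₀ ℕ, (∃ s : Multiset σ, (s.map b).sum = u + v) →
    (∃ s : Multiset σ, (s.map b).sum = u) → ∃ s : Multiset σ, (s.map b).sum = v
  exists_degree : ∀ m, ∀ d ∈ G m, ∃ D : (ι →₀ ℕ) →+ (Fin m → ℕ),
    (∀ s, D (b s) = (d s).coords) ∧ ∀ (s : Multiset σ) (a : Multiset (Veronese k m)),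
      D (s.map b).sum = (a.map Veronese.coords).sum →
        ∃ t : Multiset σ, t.map d = a ∧ (t.map b).sum = (s.map b).sum

theorem IsMonomialModel.isDomain {I : Ideal (MvPolynomial σ K)}
    {G : ∀ m, Set (σ → Veronese k m)} {b : σ → ι →₀ ℕ} (h : IsMonomialModel I G b) :
    IsDomain (MvPolynomial σ K ⧸ I) := by
  rw [h.ideal_eq]
  exact isDomain_quotient_ker_monomialHom b

theorem IsMonomialModel.isIntegrallyClosed {I : Ideal (MvPolynomial σ K)}
    {G : ∀ m, Set (σ → Veronese k m)} {b : σ → ι →₀ ℕ} (h : IsMonomialModel I G b) :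
    IsIntegrallyClosed (MvPolynomial σ K ⧸ I) := by
  rw [h.ideal_eq]
  refine isIntegrallyClosed_quotient_ker_monomialHom b ?_
  simp only [exists_linearCombination_nat_iff]
  exact h.exists_sum_eq_of_add

/-- The exponent vectors of the Veronese configuration. -/
noncomputable def veroneseExponent (k n : ℕ) (v : Veronese k n) : Fin n →₀ ℕ :=
  Finsupp.equivFunOnFinite.symm v.coords

/-- The linear map `ℕ^n → ℕ^m` that sums the coordinates over the blocks of a partition. -/
def blockSum {n m : ℕ} (p : Fin n → Fin m) : (Fin n →₀ ℕ) →+ (Fin m → ℕ) where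
  toFun u j := ∑ i with p i = j, u i
  map_zero' := by ext; simp
  map_add' u v := by ext; simp [Finset.sum_add_distrib]

theorem blockSum_veroneseExponent {n m : ℕ} (p : Fin n → Fin m) (v : Veronese k n) :
    blockSum p (veroneseExponent k n v) = (Veronese.push p v).coords := rfl

/-- The lifting property for Veronese monoids: split off below `u` a vector with block sums `a`, and
recurse on the rest. -/
theorem exists_multiset_veronese {n m : ℕ} (p : Fin n → Fin m) (a : Multiset (Veronese k m)) :
    ∀ u : Fin n →₀ ℕ, blockSum p u = (a.map Veronese.coords).sum →
      ∃ t : Multiset (Veronese k n), t.map (Veronese.push p) = a ∧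
        (t.map (veroneseExponent k n)).sum = u := by
  induction a using Multiset.induction with
  | empty =>
    intro u hu
    refine ⟨0, rfl, ?_⟩
    ext i
    have h : ∑ l with p l = p i, u l = 0 := congrFun hu (p i)
    exact (Finset.sum_eq_zero_iff.mp h i (by simp)).symm
  | cons a s ih =>
    intro u hu
    rw [Multiset.map_cons, Multiset.sum_cons] at hu
    obtain ⟨v, hvu, hv⟩ := exists_le_fiberSum_eq p u a.coords fun j =>
      (Nat.le_add_right _ _).trans (congrFun hu j).ge
    let v' : Veronese k n := ⟨v, by
      rw [← Finset.sum_fiberwise _ p]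
      simp only [hv]
      exact a.2⟩
    have hpush : Veronese.push p v' = a := Subtype.ext (funext hv)
    have hadd : veroneseExponent k n v' + (u - veroneseExponent k n v') = u :=
      add_tsub_cancel_of_le fun i => hvu i
    obtain ⟨t, ht, htu⟩ := ih (u - veroneseExponent k n v') (by
      rw [← hadd, map_add, blockSum_veroneseExponent, hpush] at hu
      exact add_left_cancel hu)
    exact ⟨v' ::ₘ t, by simp [ht, hpush], by simp [htu, hadd]⟩

theorem exists_multiset_veronese_iff {n : ℕ} (u : Fin n →₀ ℕ) :
    (∃ t : Multiset (Veronese k n), (t.map (veroneseExponent k n)).sum = u) ↔ k ∣ ∑ i, u i := by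
  constructor
  · rintro ⟨t, rfl⟩
    induction t using Multiset.induction with
    | empty => simp
    | cons v t ih =>
      simp only [Multiset.map_cons, Multiset.sum_cons, Finsupp.add_apply, Finset.sum_add_distrib]
      exact dvd_add (dvd_of_eq v.2.symm) ih
  · rintro ⟨r, hr⟩
    -- With a single block, lifting `r` copies of the vector `(k)` writes `u` as a sum of `r`
    -- generators.
    let a : Veronese k 1 := ⟨fun _ => k, by simp⟩
    have ha : a.coords = fun _ => k := rfl
    obtain ⟨t, -, ht⟩ := exists_multiset_veronese (fun _ => 0) (Multiset.replicate r a) u (by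
      ext j
      simp [blockSum, hr, Subsingleton.elim j 0, mul_comm, ha])
    exact ⟨t, ht⟩

theorem isMonomialModel_veronese (n : ℕ) :
    IsMonomialModel (veroneseIdeal K k n) (fun m => {d | ∃ p : Fin n → Fin m, d = Veronese.push p})
      (veroneseExponent k n) where
  ideal_eq := toricIdeal_eq_ker_monomialHom (veroneseExponent k n)
  exists_sum_eq_of_add u v := by
    simp only [exists_multiset_veronese_iff, Finsupp.add_apply, Finset.sum_add_distrib]
    exact fun huv hu => (Nat.dvd_add_right hu).mp huv
  exists_degree m d hd := by
    obtain ⟨p, rfl⟩ := hd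
    exact ⟨blockSum p, blockSum_veroneseExponent p, fun s a h => exists_multiset_veronese p a _ h⟩

theorem map_sum_eq_sum_degree {m : ℕ} {b : σ → ι →₀ ℕ} {d : σ → Veronese k m}
    {D : (ι →₀ ℕ) →+ (Fin m → ℕ)} (hD : ∀ s, D (b s) = (d s).coords) (s : Multiset σ) :
    D (s.map b).sum = ((s.map d).map Veronese.coords).sum := by
  rw [map_multiset_sum, Multiset.map_map, Multiset.map_map]
  exact congrArg Multiset.sum (Multiset.map_congr rfl fun s _ => hD s)

theorem sum_map_fiberConfiguration {A : Type*} (d : σ → A) (e : τ → A) (b : σ → ι →₀ ℕ)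
    (c : τ → κ →₀ ℕ) (z : Multiset (FiberIndex d e)) :
    (z.map (fiberConfiguration d e b c)).sum = Finsupp.sumFinsuppAddEquivProdFinsupp.symm
      (((z.map FiberIndex.left).map b).sum, ((z.map FiberIndex.right).map c).sum) := by
  induction z using Multiset.induction with
  | empty => simp
  | cons x z ih =>
    simp only [Multiset.map_cons, Multiset.sum_cons, ih, fiberConfiguration, ← map_add,
      Prod.mk_add_mk]

theorem IsMonomialModel.toricFiberProduct {I : Ideal (MvPolynomial σ K)}
    {J : Ideal (MvPolynomial τ K)} {G : ∀ m, Set (σ → Veronese k m)}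
    {H : ∀ m, Set (τ → Veronese k m)} {b : σ → ι →₀ ℕ} {c : τ → κ →₀ ℕ}
    (hX : IsMonomialModel I G b) (hY : IsMonomialModel J H c) {m : ℕ}
    {d : σ → Veronese k m} (hd : d ∈ G m) {e : τ → Veronese k m} (he : e ∈ H m) :
    IsMonomialModel (toricFiberProduct d e I J)
      (fun m' => {f | (∃ d' ∈ G m', f = fun z => d' z.left) ∨ ∃ e' ∈ H m', f = fun z => e' z.right})
      (fiberConfiguration d e b c) := by
  obtain ⟨D, hD, hDX⟩ := hX.exists_degree m d hd
  obtain ⟨E, hE, hEY⟩ := hY.exists_degree m e he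
  let φ : (ι ⊕ κ →₀ ℕ) ≃+ (ι →₀ ℕ) × (κ →₀ ℕ) := Finsupp.sumFinsuppAddEquivProdFinsupp
  have hsum : ∀ z : Multiset (FiberIndex d e), φ (z.map (fiberConfiguration d e b c)).sum =
      (((z.map FiberIndex.left).map b).sum, ((z.map FiberIndex.right).map c).sum) := fun z => by
    rw [sum_map_fiberConfiguration]
    exact φ.apply_symm_apply _
  have hde : ∀ z : Multiset (FiberIndex d e),
      (z.map FiberIndex.left).map d = (z.map FiberIndex.right).map e := fun z => by
    simp only [Multiset.map_map, Function.comp_def]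
    exact Multiset.map_congr rfl fun x _ => x.2
  -- The monoid is the fiber product over the degree maps. For the converse, `hEY` rewrites the
  -- right component with the degrees of the left one, and the two are then matched.
  have hmem : ∀ w, (∃ z : Multiset (FiberIndex d e),
      (z.map (fiberConfiguration d e b c)).sum = w) ↔
      (∃ s : Multiset σ, (s.map b).sum = (φ w).1) ∧
      (∃ t : Multiset τ, (t.map c).sum = (φ w).2) ∧ D (φ w).1 = E (φ w).2 := by
    intro w
    constructor
    · rintro ⟨z, rfl⟩
      rw [hsum]
      exact ⟨⟨_, rfl⟩, ⟨_, rfl⟩, by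
        rw [map_sum_eq_sum_degree hD, map_sum_eq_sum_degree hE, hde]⟩
    · rintro ⟨⟨s, hs⟩, ⟨t, ht⟩, h⟩
      obtain ⟨t', ht', htt⟩ := hEY t (s.map d) (by
        rw [ht, ← h, ← hs, map_sum_eq_sum_degree hD])
      obtain ⟨z, hz₁, hz₂⟩ := Multiset.exists_map_fst_snd_of_map_eq d e ht'.symm
      exact ⟨z, φ.injective (by rw [hsum, hz₁, hz₂, hs, htt, ht])⟩
  refine ⟨?_, fun u v => ?_, fun m' f hf => ?_⟩
  · rw [hX.ideal_eq, hY.ideal_eq]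
    exact toricFiberProduct_ker_monomialHom d e b c
  · rw [hmem, hmem, hmem, map_add]
    rintro ⟨hs, ht, h⟩ ⟨hs', ht', h'⟩
    refine ⟨hX.exists_sum_eq_of_add _ _ hs hs', hY.exists_sum_eq_of_add _ _ ht ht', ?_⟩
    simp only [Prod.fst_add, Prod.snd_add, map_add, h'] at h
    exact add_left_cancel h
  · obtain ⟨d', hd', rfl⟩ | ⟨e', he', rfl⟩ := hf
    · obtain ⟨D', hD', hDX'⟩ := hX.exists_degree m' d' hd'
      refine ⟨D'.comp ((AddMonoidHom.fst _ _).comp φ.toAddMonoidHom), fun z => ?_,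
        fun (z : Multiset (FiberIndex d e)) a h => ?_⟩
      · exact (congrArg (fun w => D' w.1) (φ.apply_symm_apply (b z.left, c z.right))).trans (hD' _)
      · change D' (φ _).1 = _ at h
        rw [hsum] at h
        obtain ⟨s, hs, hsz⟩ := hDX' _ a h
        -- Lifting on the left may change the common degrees of the summands but not their total, so
        -- the right component can be decomposed anew to match.
        obtain ⟨t, ht, htz⟩ := hEY (z.map FiberIndex.right) (s.map d) (by
          rw [map_sum_eq_sum_degree hE, ← hde, ← map_sum_eq_sum_degree hD, ← hsz,
            map_sum_eq_sum_degree hD])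
        obtain ⟨y, rfl, rfl⟩ := Multiset.exists_map_fst_snd_of_map_eq d e ht.symm
        refine ⟨y, by rw [← hs, Multiset.map_map]; rfl, φ.injective ?_⟩
        exact (hsum y).trans ((Prod.ext hsz htz).trans (hsum z).symm)
    · obtain ⟨E', hE', hEY'⟩ := hY.exists_degree m' e' he'
      refine ⟨E'.comp ((AddMonoidHom.snd _ _).comp φ.toAddMonoidHom), fun z => ?_,
        fun (z : Multiset (FiberIndex d e)) a h => ?_⟩
      · exact (congrArg (fun w => E' w.2) (φ.apply_symm_apply (b z.left, c z.right))).trans (hE' _)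
      · change E' (φ _).2 = _ at h
        rw [hsum] at h
        obtain ⟨t, ht, htz⟩ := hEY' _ a h
        obtain ⟨s, hs, hsz⟩ := hDX (z.map FiberIndex.left) (t.map e) (by
          rw [map_sum_eq_sum_degree hD, hde, ← map_sum_eq_sum_degree hE, ← htz,
            map_sum_eq_sum_degree hE])
        obtain ⟨y, rfl, rfl⟩ := Multiset.exists_map_fst_snd_of_map_eq d e hs
        refine ⟨y, by rw [← ht, Multiset.map_map]; rfl, φ.injective ?_⟩
        exact (hsum y).trans ((Prod.ext hsz htz).trans (hsum z).symm)

end MonomialModel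

theorem GradedIdeal.IsIteratedVeronese.exists_isMonomialModel {K : Type*} [Field K] {k : ℕ}
    {X : GradedIdeal K k} (hX : X.IsIteratedVeronese) :
    ∃ (ι : Type) (b : X.Var → ι →₀ ℕ), IsMonomialModel X.ideal X.gradings b := by
  induction hX with
  | veronese n _ => exact ⟨_, _, isMonomialModel_veronese n⟩
  | tfp X Y _ _ m d hd e he ihX ihY =>
    obtain ⟨ι, b, hb⟩ := ihX
    obtain ⟨κ, c, hc⟩ := ihY
    exact ⟨_, _, hb.toricFiberProduct hc hd he⟩

/-- The quotient by an iterated toric fiber product of Veronese ideals is a normal domain. -/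
theorem mainTheorem6 (K : Type*) [Field K] (k : ℕ) (hk : 0 < k) (X : GradedIdeal K k)
    (hX : X.IsIteratedVeronese) :
    IsDomain (MvPolynomial X.Var K ⧸ X.ideal) ∧
      IsIntegrallyClosed (MvPolynomial X.Var K ⧸ X.ideal) := by
  obtain ⟨ι, b, hb⟩ := hX.exists_isMonomialModel
  exact ⟨hb.isDomain, hb.isIntegrallyClosed⟩
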